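/- Let $M=\mathbb R^n$, and let $U\subset TM=\mathbb R^n\times\mathbb R^n$ be an open set of nonzero tangent vectors which is conic ($(x,y)\in U$, $t>0$ imply $(x,ty)\in U$). A Finsler function on $U$ is a smooth function $F:U\to(0,\infty)$ with $F(x,ty)=tF(x,y)$ for $t>0$, whose fundamental tensor $g_{ij}=\frac12\,\partial^2F^2/\partial y^i\partial y^j$ is nondegenerate (of any signature). For a linear connection $D$ on the pullback bundle $\pi^{-1}(TM)$ over $U$ let $\eta(z)=(z,z)$, $V_z=\operatorname{Ker}\pi_*$, $H_z=\{X\in T_zU: D_X\eta=0\}$; $D$ is regular if $T_zU=V_z\oplus H_z$ for all $z\in U$. Let $\mathbf T(X,Y)=D_X\pi_*Y-D_Y\pi_*X-\pi_*[X,Y]$ and $\mathbf K(X,Y)\overline Z=D_XD_Y\overline Z-D_YD_X\overline Z-D_{[X,Y]}\overline Z$. The Cartan connection of $F$ is the smooth regular linear connection on $\pi^{-1}(TM)$ with $Dg=0$, with $\mathbf T(X,Y)=0$ for $X,Y$ horizontal, and with $g(\mathbf T(X,Y),\pi_*Z)=g(\mathbf T(X,Z),\pi_*Y)$ for $X$ vertical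 and $Y,Z$ horizontal. The restriction of its curvature $\mathbf K$ to horizontal vectors $X,Y$ is the h-curvature $R$. For $z\in U$, $x=\pi z$, the nullity space and the kernel of $R$ are the subsets $$\mathcal N_R(x)=\pi_*\{X\in H_z:\mathbf K(X,Y)=0\ \ \forall\,Y\in H_z\},\qquad \mathrm{Ker}_R(x)=\{Z\in T_xM:\mathbf K(X,Y)Z=0\ \ \forall\,X,Y\in H_z\}$$ of $T_xM$ (both taken at $z$). Theorem. The spaces $\mathcal N_R(x)$ and $\mathrm{Ker}_R(x)$ do not coincide in general. More precisely, let $M=\mathbb R^3$ and let $U\neq\emptyset$ be the set of all $(x_1,x_2,x_3;y_1,y_2,y_3)\in T\mathbb R^3$ with $x_3y_1>0$ and $y_2^2+y_3^2\ne0$. Then $F=\sqrt{x_3\,y_1\sqrt{y_2^2+y_3^2}}$ is a Finsler function on $U$, its Cartan connection exists and is unique, and at every $z=(x;y)\in U$ $$\mathcal N_R(x)=\mathbb R\,\frac{\partial}{\partial x^1},\qquad \mathrm{Ker}_R(x)=\mathbb R\Big(\frac{\partial}{\partial x^1}-\frac{y_2}{y_1}\frac{\partial}{\partial x^2}-\frac{y_3}{y_1}\frac{\partial}{\partial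 x^3}\Big),$$ so that $\mathcal N_R(x)\neq\mathrm{Ker}_R(x)$. -/

import Mathlib

open scoped ContDiff Manifold

/-!
A vector space `E` is regarded as a manifold `M = E`, so that `TM = E × E`, a point of `TM` being
`z = (x, y)` with `y` a tangent vector at `x`, and `π = Prod.fst`. A tangent vector of `TM` at `z`
is an element of `E × E`, and `π_* = Prod.fst`. The pullback bundle `π⁻¹(TM)` is the trivial bundle
over `E × E` with fibre `E`. All objects live over an open subset `U` of `TM`.
-/

namespace Finsler

noncomputable section

variable {E : Type*} [NormedAddCommGroup E] [NormedSpace ℝ E]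

/-- The fundamental tensor `g_z(u, v) = ½ ∂²F²/∂y² (u, v)` of `F`: second derivative along the
fibre. -/
def fundTensor (F : E × E → ℝ) (z : E × E) (u v : E) : ℝ :=
  (1 / 2) * fderiv ℝ (fun y => fderiv ℝ (fun y' => F (z.1, y') ^ 2) y v) z.2 u

/-- `F` is a Finsler function on the conic open set `U` of nonzero tangent vectors: smooth, positive,
positively homogeneous of degree one along the fibres, with nondegenerate fundamental tensor
(of any signature). -/
structure IsFinslerFunction (U : Set (E × E)) (F : E × E → ℝ) : Prop where
  isOpen : IsOpen U
  ne_zero : ∀ z ∈ U, z.2 ≠ 0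
  conic : ∀ z ∈ U, ∀ t : ℝ, 0 < t → (z.1, t • z.2) ∈ U
  smooth : ContDiffOn ℝ ∞ F U
  pos : ∀ z ∈ U, 0 < F z
  homogeneous : ∀ z ∈ U, ∀ t : ℝ, 0 < t → F (z.1, t • z.2) = t * F z
  nondegenerate : ∀ z ∈ U, ∀ u : E, (∀ v : E, fundTensor F z u v = 0) → u = 0

/-- Candidate covariant derivatives on the pullback bundle: `D σ z X` is `D_X σ` at `z`, for a
`π`-vector field `σ` and a tangent vector `X` of `TM` at `z`. -/
abbrev PullbackDeriv (E : Type*) [NormedAddCommGroup E] [NormedSpace ℝ E] : Type _ :=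
  (E × E → E) → (E × E → (E × E →L[ℝ] E))

/-- `D` is a smooth linear connection on the pullback bundle over `U`. -/
structure IsLinearConnection (U : Set (E × E)) (D : PullbackDeriv E) : Prop where
  isCovariantDerivative :
    IsCovariantDerivativeOn (I := 𝓘(ℝ, E × E)) (V := Bundle.Trivial (E × E) E) E D U
  smooth : ∀ σ : E × E → E, ContDiffOn ℝ ∞ σ U → ContDiffOn ℝ ∞ (D σ) U

/-- The fundamental `π`-vector field `η(z) = (z, z)`. -/
def eta : E × E → E := fun z => z.2

/-- The vertical space `V_z = Ker π_*`. -/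
def vert (_z : E × E) : Submodule ℝ (E × E) :=
  LinearMap.ker (LinearMap.fst ℝ E E)

/-- The horizontal space `H_z = {X | D_X η = 0}` of `D`. -/
def hor (D : PullbackDeriv E) (z : E × E) : Submodule ℝ (E × E) :=
  LinearMap.ker (D eta z).toLinearMap

/-- The classical torsion `D_X (π_* Y) - D_Y (π_* X) - π_* [X, Y]` for vector fields on `TM`. -/
def torsion (D : PullbackDeriv E) (X Y : E × E → E × E) (z : E × E) : E :=
  D (fun w => (Y w).1) z (X z) - D (fun w => (X w).1) z (Y z)
    - (VectorField.lieBracket ℝ X Y z).1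

/-- The classical curvature `D_X D_Y σ - D_Y D_X σ - D_[X, Y] σ` for vector fields on `TM` and a
`π`-vector field `σ`. -/
def curvature (D : PullbackDeriv E) (X Y : E × E → E × E) (σ : E × E → E) (z : E × E) : E :=
  D (fun w => D σ w (Y w)) z (X z) - D (fun w => D σ w (X w)) z (Y z)
    - D σ z (VectorField.lieBracket ℝ X Y z)

/-- The torsion tensor at `z`. The value does not depend on the smooth extensions of the vectors to
vector fields; constant extensions are used. -/
def torsionAt (D : PullbackDeriv E) (z X Y : E × E) : E :=
  torsion D (fun _ => X) (fun _ => Y) z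

/-- The curvature tensor at `z`. The value does not depend on the smooth extensions of the vectors
to fields; constant extensions are used. On horizontal `X`, `Y` it is the h-curvature
`R(π_* X, π_* Y) Z`. -/
def curvatureAt (D : PullbackDeriv E) (z X Y : E × E) (Z : E) : E :=
  curvature D (fun _ => X) (fun _ => Y) (fun _ => Z) z

/-- `D` is the Cartan connection of `F` over `U`: a regular linear connection which is metrical,
has no horizontal torsion, and whose ((h)hv)-torsion `T` satisfies `g(T(X, Y), Z) = g(T(X, Z), Y)`. -/
structure IsCartanConnection (U : Set (E × E)) (F : E × E → ℝ) (D : PullbackDeriv E) : Prop where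
  isLinearConnection : IsLinearConnection U D
  regular : ∀ z ∈ U, IsCompl (vert z) (hor D z)
  metrical : ∀ σ τ : E × E → E, ContDiffOn ℝ ∞ σ U → ContDiffOn ℝ ∞ τ U → ∀ z ∈ U, ∀ X : E × E,
    fderiv ℝ (fun w => fundTensor F w (σ w) (τ w)) z X =
      fundTensor F z (D σ z X) (τ z) + fundTensor F z (σ z) (D τ z X)
  torsion_hor : ∀ z ∈ U, ∀ X ∈ hor D z, ∀ Y ∈ hor D z, torsionAt D z X Y = 0
  torsion_symm : ∀ z ∈ U, ∀ X ∈ vert z, ∀ Y ∈ hor D z, ∀ Z ∈ hor D z,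
    fundTensor F z (torsionAt D z X Y) Z.1 = fundTensor F z (torsionAt D z X Z) Y.1

/-- The nullity space inside the horizontal space:
`{X ∈ H_z | K(X, Y) = 0 for all Y ∈ H_z}`. -/
def nullityHor (D : PullbackDeriv E) (z : E × E) : Set (E × E) :=
  {X | X ∈ hor D z ∧ ∀ Y ∈ hor D z, ∀ Z : E, curvatureAt D z X Y Z = 0}

/-- The nullity space of the h-curvature: the image in `T_x M` under `π_*`. -/
def nullity (D : PullbackDeriv E) (z : E × E) : Set E :=
  Prod.fst '' nullityHor D z

/-- The kernel of the h-curvature: `{Z ∈ T_x M | K(X, Y) Z = 0 for all X, Y ∈ H_z}`. -/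
def kernel (D : PullbackDeriv E) (z : E × E) : Set E :=
  {Z | ∀ X ∈ hor D z, ∀ Y ∈ hor D z, curvatureAt D z X Y Z = 0}

/-- The set `U ⊆ Tℝ³` given by `x₃ y₁ > 0`, `y₂² + y₃² ≠ 0`. -/
def exampleSet : Set ((Fin 3 → ℝ) × (Fin 3 → ℝ)) :=
  {z | 0 < z.1 2 * z.2 0 ∧ z.2 1 ^ 2 + z.2 2 ^ 2 ≠ 0}

/-- The function `F = √(x₃ y₁ √(y₂² + y₃²))`. -/
def exampleF (z : (Fin 3 → ℝ) × (Fin 3 → ℝ)) : ℝ :=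
  √(z.1 2 * z.2 0 * √(z.2 1 ^ 2 + z.2 2 ^ 2))

end

end Finsler

/-!
Write `ρ = √(y₂² + y₃²)`, so that `F² = x₃ y₁ ρ`. In the frame `e₁`, `r` (radial), `t` (angular) of the
fibre, `g` has the only entries `g(e₁, r) = x₃ / 2` and `g(t, t) = x₃ y₁ / (2ρ)`, hence is
nondegenerate. The geodesic spray of `F` is that of the Levi-Civita connection `Γ` of the metric
`x₃² (dx₂² + dx₃²)` in the `(2, 3)`-plane, extended by zero (`christoffel`). It is quadratic in `y`
(`F` is a Berwald metric), so `Γ` is the horizontal part of the Cartan connection; the vertical part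
is the Cartan tensor `C = ½ ∂g/∂y` with an index raised (`cartanTensor`). Together they give the
connection form
`A_X b = Γ(X₁, b) + C(X₂ + Γ(X₁, y), b)` (`cartanForm`), whose compatibility with `g` is
`hasDerivAt_exampleMetric`.

Uniqueness is linear algebra in one fibre (`connectionForm_unique`). The symmetry of the vertical
torsion and metricity determine the form on vertical vectors. The difference `S` of two forms on the
remaining vectors is skew for `g`; the vanishing of the horizontal torsion first forces `S(·, y) = 0`,
which makes the horizontal spaces agree, and then makes `S` symmetric, so that the usual
three-term permutation argument gives `S = 0`.

For horizontal `X`, `Y` the curvature is `R(X₁, Y₁) Z + C(R(X₁, Y₁) y, Z)`, where `R` is the curvature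
of `Γ`. The conformal factor `x₃²` has `R(a, b) = (a₂ b₃ - a₃ b₂) / x₃² · J`, with `J` the rotation
by a right angle in the `(2, 3)`-plane (`IsCartanConnection.curvatureAt_hor`). Hence the nullity space
is given by `a₂ = a₃ = 0`, while the kernel is that of `Z ↦ J Z + C(J y, Z)`, which is the line
spanned by `(1, -y₂/y₁, -y₃/y₁)` (`rot_add_cartanTensor_eq_zero_iff`).

Indices are shifted in the code: `x₃`, `y₁`, `y₂`, `y₃` are `z.1 2`, `z.2 0`, `z.2 1`, `z.2 2`.
-/

namespace Finsler

/-! ### Linear connections and their connection forms -/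

section LinearConnections

variable {E : Type*} [NormedAddCommGroup E] [NormedSpace ℝ E]

open Bundle in
lemma mdifferentiableAt_section_iff {σ : E × E → E} {z : E × E} :
    MDifferentiableAt 𝓘(ℝ, E × E) (𝓘(ℝ, E × E).prod 𝓘(ℝ, E))
      (fun w => TotalSpace.mk' E (E := Bundle.Trivial (E × E) E) w (σ w)) z ↔
      DifferentiableAt ℝ σ z := by
  rw [mdifferentiableAt_section, ← mdifferentiableAt_iff_differentiableAt]
  rfl

/-- The flat connection `σ ↦ dσ` of the trivial bundle. -/
lemma isCovariantDerivativeOn_fderiv (U : Set (E × E)) :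
    IsCovariantDerivativeOn (I := 𝓘(ℝ, E × E)) (V := Bundle.Trivial (E × E) E) E
      (fun σ z => fderiv ℝ (fun w => (σ w : E)) z) U where
  add hσ hσ' _ := by
    rw [mdifferentiableAt_section_iff] at hσ hσ'
    exact fderiv_add hσ hσ'
  leibniz {σ g x} hσ hg _ := by
    rw [mdifferentiableAt_section_iff] at hσ
    rw [mdifferentiableAt_iff_differentiableAt] at hg
    have := fderiv_smul hg hσ
    rw [mvfderiv, mfderiv_eq_fderiv]
    exact this

variable {U : Set (E × E)} {D : PullbackDeriv E} {z : E × E}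

/-- A linear connection of the trivial bundle is the flat one plus an endomorphism-valued one-form
`A`, which is the value of the connection on constant sections. -/
lemma IsLinearConnection.exists_connectionForm [FiniteDimensional ℝ E]
    (hD : IsLinearConnection U D) (hz : z ∈ U) :
    ∃ A : E →L[ℝ] (E × E →L[ℝ] E),
      ∀ σ : E × E → E, DifferentiableAt ℝ σ z → D σ z = fderiv ℝ σ z + A (σ z) := by
  refine ⟨IsCovariantDerivativeOn.difference hD.isCovariantDerivative
    (isCovariantDerivativeOn_fderiv U) z, fun σ hσ => ?_⟩
  have h := IsCovariantDerivativeOn.difference_apply hD.isCovariantDerivative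
    (isCovariantDerivativeOn_fderiv U) hz (σ := σ) (mdifferentiableAt_section_iff.2 hσ)
  erw [h]
  exact (add_sub_cancel _ _).symm

end LinearConnections

/-! ### Torsion, curvature and uniqueness in terms of the connection form -/

section Uniqueness

variable {E : Type*} [NormedAddCommGroup E] [NormedSpace ℝ E]

/-- Uniqueness of the Cartan connection at one point, in terms of the values `A b X` of the
connection forms. The argument `y` is the base vector; `X.2 + A y X = 0` says that `X` is
horizontal. -/
lemma connectionForm_unique (g : LinearMap.BilinForm ℝ E) (hsymm : ∀ u v, g u v = g v u)
    (hnd : ∀ u, (∀ v, g u v = 0) → u = 0) (y : E) (A B : E →L[ℝ] (E × E →L[ℝ] E))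
    (hmet : ∀ X b c, g (A b X) c + g b (A c X) = g (B b X) c + g b (B c X))
    (hvA : ∀ v b c, g (A b (0, v)) c = g (A c (0, v)) b)
    (hvB : ∀ v b c, g (B b (0, v)) c = g (B c (0, v)) b)
    (hBy : ∀ v, B y (0, v) = 0)
    (hhA : ∀ X Y : E × E, X.2 + A y X = 0 → Y.2 + A y Y = 0 → A Y.1 X = A X.1 Y)
    (hhB : ∀ X Y : E × E, X.2 + B y X = 0 → Y.2 + B y Y = 0 → B Y.1 X = B X.1 Y) :
    A = B := by
  have split : ∀ (C : E →L[ℝ] (E × E →L[ℝ] E)) (b a v : E),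
      C b (a, v) = C b (a, 0) + C b (0, v) := fun C b a v => by
    rw [← map_add, Prod.mk_add_mk, add_zero, zero_add]
  -- vertical directions: half the derivative of the metric on both sides
  have hvert : ∀ b v, A b (0, v) = B b (0, v) := by
    intro b v
    rw [← sub_eq_zero]
    refine hnd _ fun c => ?_
    have h1 := hmet (0, v) b c
    rw [hsymm b, hsymm b, ← hvA v b c, ← hvB v b c] at h1
    rw [map_sub, LinearMap.sub_apply]
    linarith
  -- `S a b` is the difference of the two forms on `b`, in a direction over `a`
  let S : E → E → E := fun a b => A b (a, 0) - B b (a, 0)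
  have hAS : ∀ b a v, A b (a, v) = B b (a, v) + S a b := by
    intro b a v
    rw [split A, split B, hvert]
    simp only [S]
    abel
  have hskew : ∀ a b c, g (S a b) c = - g (S a c) b := by
    intro a b c
    have := hmet (a, 0) b c
    rw [hsymm b, hsymm b] at this
    simp only [S, map_sub, LinearMap.sub_apply]
    linarith
  have hsplit : ∀ a v, B y (a, v) = B y (a, 0) := fun a v => by rw [split, hBy, add_zero]
  -- the horizontal lifts of `a` for the two forms differ by the vertical vector `S a y`
  have htor : ∀ a b, S a b - B b (0, S a y) = S b a - B a (0, S b y) := by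
    intro a b
    have hB := hhB (a, - B y (a, 0)) (b, - B y (b, 0)) (by simp [hsplit a]) (by simp [hsplit b])
    have hA := hhA (a, - B y (a, 0) - S a y) (b, - B y (b, 0) - S b y)
      (by rw [hAS, hsplit a (- B y (a, 0) - S a y)]; simp)
      (by rw [hAS, hsplit b (- B y (b, 0) - S b y)]; simp)
    have e : ∀ c d : E, B c (d, - B y (d, 0) - S d y)
        = B c (d, - B y (d, 0)) - B c (0, S d y) := fun c d => by
      rw [← map_sub, Prod.mk_sub_mk, sub_zero]
    rw [hAS, hAS, e, e, hB] at hA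
    refine sub_eq_zero.1 (Eq.trans ?_ (sub_eq_zero.2 hA))
    abel
  have hBy' : ∀ v b, g (B b (0, v)) y = 0 := fun v b => by rw [hvB, hBy]; simp
  have h1 : ∀ a b, g (S a b) y = g (S b a) y := by
    intro a b
    have := congrArg (fun t => g t y) (htor a b)
    simpa [hBy'] using this
  have hyy : S y y = 0 := by
    refine hnd _ fun c => ?_
    linarith [hskew c y y, hskew y y c, h1 y c]
  have hy : ∀ a, S a y = 0 := by
    intro a
    have h0 : B y (0, S a y) = 0 := hBy _
    have h2 : ∀ a, S a y = S y a := fun a => by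
      have := htor a y
      rw [hBy, hyy, Prod.mk_zero_zero, map_zero] at this
      simpa using this
    refine hnd _ fun c => ?_
    -- `g (S a y) c` is skew in `a, c` by `h2`, and symmetric by `h1`
    have h3 := hskew y a c
    rw [← h2, ← h2] at h3
    have h4 := h1 a c
    rw [hskew a, hskew c] at h4
    linarith
  -- now `g (S a b) c` is symmetric in `a, b` and skew in `b, c`
  have h5 : ∀ a b, S a b = S b a := fun a b => by simpa [hy, Prod.mk_zero_zero] using htor a b
  have hS : ∀ a b, S a b = 0 := by
    intro a b
    refine hnd _ fun c => ?_
    have e1 := hskew a b c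
    have e2 := hskew b c a
    have e3 := hskew c a b
    rw [h5 a c] at e1
    rw [h5 b a] at e2
    rw [h5 c b] at e3
    linarith
  refine ContinuousLinearMap.ext fun b => ContinuousLinearMap.ext fun ⟨a, v⟩ => ?_
  rw [hAS, hS, add_zero]

variable {U : Set (E × E)} {F : E × E → ℝ} {D D' : PullbackDeriv E} {z : E × E}

lemma mem_hor_iff {A : E →L[ℝ] (E × E →L[ℝ] E)}
    (hA : ∀ σ : E × E → E, DifferentiableAt ℝ σ z → D σ z = fderiv ℝ σ z + A (σ z)) (X : E × E) :
    X ∈ hor D z ↔ X.2 + A z.2 X = 0 := by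
  have : D eta z = ContinuousLinearMap.snd ℝ E E + A z.2 := by
    rw [hA eta differentiableAt_snd]
    exact congrArg (· + A z.2) (ContinuousLinearMap.snd ℝ E E).fderiv
  rw [hor, LinearMap.mem_ker, this]
  rfl

lemma lieBracket_const (X Y z : E × E) :
    VectorField.lieBracket ℝ (fun _ : E × E => X) (fun _ => Y) z = 0 := by
  simp [VectorField.lieBracket_eq]

lemma torsionAt_eq {A : E →L[ℝ] (E × E →L[ℝ] E)}
    (hA : ∀ σ : E × E → E, DifferentiableAt ℝ σ z → D σ z = fderiv ℝ σ z + A (σ z))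
    (X Y : E × E) : torsionAt D z X Y = A Y.1 X - A X.1 Y := by
  rw [torsionAt, torsion, lieBracket_const, hA _ (differentiableAt_const _),
    hA _ (differentiableAt_const _)]
  simp

/-- The symmetry of the torsion extends to all fibre vectors because `H_z` projects onto the
fibre. -/
lemma IsCartanConnection.torsion_vert (hD : IsCartanConnection U F D) (hz : z ∈ U)
    {A : E →L[ℝ] (E × E →L[ℝ] E)}
    (hA : ∀ σ : E × E → E, DifferentiableAt ℝ σ z → D σ z = fderiv ℝ σ z + A (σ z))
    (v b c : E) : fundTensor F z (A b (0, v)) c = fundTensor F z (A c (0, v)) b := by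
  have hsurj : ∀ b : E, ∃ X ∈ hor D z, X.1 = b := by
    intro b
    have : ((b, 0) : E × E) ∈ vert z ⊔ hor D z := by
      rw [(hD.regular z hz).sup_eq_top]; trivial
    obtain ⟨V, hV, X, hX, h⟩ := Submodule.mem_sup.1 this
    refine ⟨X, hX, ?_⟩
    have h1 := congrArg Prod.fst h
    have hV' : V.1 = 0 := hV
    simpa [hV'] using h1
  obtain ⟨Y, hY, rfl⟩ := hsurj b
  obtain ⟨Z, hZ, rfl⟩ := hsurj c
  have := hD.torsion_symm z hz (0, v) (by simp [vert]) Y hY Z hZ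
  simpa [torsionAt_eq hA] using this

lemma IsCartanConnection.torsion_hor_eq (hD : IsCartanConnection U F D) (hz : z ∈ U)
    {A : E →L[ℝ] (E × E →L[ℝ] E)}
    (hA : ∀ σ : E × E → E, DifferentiableAt ℝ σ z → D σ z = fderiv ℝ σ z + A (σ z))
    (X Y : E × E) (hX : X.2 + A z.2 X = 0) (hY : Y.2 + A z.2 Y = 0) : A Y.1 X = A X.1 Y := by
  have := hD.torsion_hor z hz X ((mem_hor_iff hA X).2 hX) Y ((mem_hor_iff hA Y).2 hY)
  rwa [torsionAt_eq hA, sub_eq_zero] at this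

lemma IsCartanConnection.fderiv_fundTensor (hD : IsCartanConnection U F D) (hz : z ∈ U)
    {A : E →L[ℝ] (E × E →L[ℝ] E)}
    (hA : ∀ σ : E × E → E, DifferentiableAt ℝ σ z → D σ z = fderiv ℝ σ z + A (σ z))
    (X : E × E) (b c : E) :
    fderiv ℝ (fun w => fundTensor F w b c) z X =
      fundTensor F z (A b X) c + fundTensor F z b (A c X) := by
  have := hD.metrical (fun _ => b) (fun _ => c) contDiffOn_const contDiffOn_const z hz X
  rw [hA _ (differentiableAt_const _), hA _ (differentiableAt_const _)] at this
  simpa using this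

/-- Two Cartan connections of the same function have the same connection form at a point where the
fundamental tensor is symmetric, bilinear and nondegenerate, provided that one of them satisfies
`D_V η = V` for vertical `V`, that is, its form annihilates `(z.2, V)`. -/
lemma IsCartanConnection.connectionForm_eq (hD : IsCartanConnection U F D)
    (hD' : IsCartanConnection U F D') (hz : z ∈ U) (g : LinearMap.BilinForm ℝ E)
    (hg : ∀ u v, fundTensor F z u v = g u v) (hsymm : ∀ u v, g u v = g v u)
    (hnd : ∀ u, (∀ v, g u v = 0) → u = 0) {A B : E →L[ℝ] (E × E →L[ℝ] E)}
    (hA : ∀ σ : E × E → E, DifferentiableAt ℝ σ z → D σ z = fderiv ℝ σ z + A (σ z))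
    (hB : ∀ σ : E × E → E, DifferentiableAt ℝ σ z → D' σ z = fderiv ℝ σ z + B (σ z))
    (hBy : ∀ v, B z.2 (0, v) = 0) : A = B := by
  refine connectionForm_unique g hsymm hnd z.2 A B (fun X b c => ?_) (fun v b c => ?_)
    (fun v b c => ?_) hBy (hD.torsion_hor_eq hz hA) (hD'.torsion_hor_eq hz hB)
  · simp only [← hg]
    rw [← hD.fderiv_fundTensor hz hA, ← hD'.fderiv_fundTensor hz hB]
  · simp only [← hg]
    exact hD.torsion_vert hz hA v b c
  · simp only [← hg]
    exact hD'.torsion_vert hz hB v b c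

/-- The curvature in terms of the connection form. -/
lemma curvatureAt_eq {A : E × E → E →L[ℝ] (E × E →L[ℝ] E)} (hU : IsOpen U)
    (hA : ∀ w ∈ U, ∀ σ : E × E → E, DifferentiableAt ℝ σ w → D σ w = fderiv ℝ σ w + A w (σ w))
    (hz : z ∈ U) (X Y : E × E) (Z : E) (hX : DifferentiableAt ℝ (fun w => A w Z X) z)
    (hY : DifferentiableAt ℝ (fun w => A w Z Y) z) :
    curvatureAt D z X Y Z =
      fderiv ℝ (fun w => A w Z Y) z X + A z (A z Z Y) X
        - (fderiv ℝ (fun w => A w Z X) z Y + A z (A z Z X) Y) := by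
  have key : ∀ W : E × E, (fun w => D (fun _ => Z) w W) =ᶠ[nhds z] fun w => A w Z W := fun W => by
    filter_upwards [hU.mem_nhds hz] with w hw
    rw [hA w hw _ (differentiableAt_const _)]
    simp
  have key' : ∀ W V : E × E, DifferentiableAt ℝ (fun w => A w Z W) z →
      D (fun w => D (fun _ => Z) w W) z V =
        fderiv ℝ (fun w => A w Z W) z V + A z (A z Z W) V := by
    intro W V hW
    rw [hA z hz _ ((key W).differentiableAt_iff.2 hW), (key W).fderiv_eq, (key W).eq_of_nhds]
    rfl
  rw [curvatureAt, curvature, lieBracket_const, key' Y X hY, key' X Y hX, map_zero, sub_zero]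

end Uniqueness

noncomputable section Example

variable {z : (Fin 3 → ℝ) × (Fin 3 → ℝ)}

/-! ### The fundamental tensor of the example -/

/-- `y₂² + y₃²`. -/
def sqRad (y : Fin 3 → ℝ) : ℝ := y 1 ^ 2 + y 2 ^ 2

/-- Scalar product of the `(2, 3)`-parts of `y` and `a`. -/
def rad (y a : Fin 3 → ℝ) : ℝ := y 1 * a 1 + y 2 * a 2

/-- Determinant of the `(2, 3)`-parts of `y` and `a`. -/
def tang (y a : Fin 3 → ℝ) : ℝ := y 1 * a 2 - y 2 * a 1

/-- The fundamental tensor of `exampleF`, see `fundTensor_exampleF`. -/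
def exampleMetric (z : (Fin 3 → ℝ) × (Fin 3 → ℝ)) (u v : Fin 3 → ℝ) : ℝ :=
  z.1 2 / (2 * √(sqRad z.2)) *
    (u 0 * rad z.2 v + v 0 * rad z.2 u + z.2 0 / sqRad z.2 * (tang z.2 u * tang z.2 v))

/-- The fundamental tensor of `exampleF` as a bilinear form. -/
def exampleMetricForm (z : (Fin 3 → ℝ) × (Fin 3 → ℝ)) : LinearMap.BilinForm ℝ (Fin 3 → ℝ) :=
  LinearMap.mk₂ ℝ (exampleMetric z)
    (fun u u' v => by simp only [exampleMetric, rad, tang, Pi.add_apply]; ring)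
    (fun c u v => by simp only [exampleMetric, rad, tang, Pi.smul_apply, smul_eq_mul]; ring)
    (fun u v v' => by simp only [exampleMetric, rad, tang, Pi.add_apply]; ring)
    (fun c u v => by simp only [exampleMetric, rad, tang, Pi.smul_apply, smul_eq_mul]; ring)

lemma sqRad_pos (hz : z ∈ exampleSet) : 0 < sqRad z.2 :=
  lt_of_le_of_ne (by unfold sqRad; positivity) (Ne.symm hz.2)

lemma x_ne (hz : z ∈ exampleSet) : z.1 2 ≠ 0 := left_ne_zero_of_mul hz.1.ne'

lemma y_ne (hz : z ∈ exampleSet) : z.2 0 ≠ 0 := right_ne_zero_of_mul hz.1.ne'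

lemma isOpen_exampleSet : IsOpen exampleSet := by
  have h1 : Continuous fun z : (Fin 3 → ℝ) × (Fin 3 → ℝ) => z.1 2 * z.2 0 := by fun_prop
  have h2 : Continuous fun z : (Fin 3 → ℝ) × (Fin 3 → ℝ) => z.2 1 ^ 2 + z.2 2 ^ 2 := by fun_prop
  exact (isOpen_lt continuous_const h1).inter (isOpen_ne_fun h2 continuous_const)

lemma exampleF_sq (hz : z ∈ exampleSet) :
    exampleF z ^ 2 = z.1 2 * z.2 0 * √(sqRad z.2) :=
  Real.sq_sqrt (mul_nonneg hz.1.le (Real.sqrt_nonneg _))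

/-- A differential is computed along a line. -/
lemma fderiv_apply_eq_of_line {V W : Type*} [NormedAddCommGroup V] [NormedSpace ℝ V]
    [NormedAddCommGroup W] [NormedSpace ℝ W] {f : V → W} {x v : V} {d : W}
    (hf : DifferentiableAt ℝ f x) (h : HasDerivAt (fun t : ℝ => f (x + t • v)) d 0) :
    fderiv ℝ f x v = d :=
  hf.lineDeriv_eq_fderiv.symm.trans h.deriv

lemma hasDerivAt_line (y u : Fin 3 → ℝ) (i : Fin 3) :
    HasDerivAt (fun t : ℝ => (y + t • u) i) (u i) 0 := by
  simpa using ((hasDerivAt_id (0 : ℝ)).mul_const (u i)).const_add (y i)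

lemma hasDerivAt_sqRad {y : ℝ → Fin 3 → ℝ} {y' : Fin 3 → ℝ} {t : ℝ}
    (hy : ∀ i, HasDerivAt (fun s => y s i) (y' i) t) :
    HasDerivAt (fun s => sqRad (y s)) (2 * rad (y t) y') t := by
  refine (((hy 1).fun_pow 2).fun_add ((hy 2).fun_pow 2)).congr_deriv ?_
  simp [rad]
  ring

lemma hasDerivAt_rad {y a : ℝ → Fin 3 → ℝ} {y' a' : Fin 3 → ℝ} {t : ℝ}
    (hy : ∀ i, HasDerivAt (fun s => y s i) (y' i) t)
    (ha : ∀ i, HasDerivAt (fun s => a s i) (a' i) t) :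
    HasDerivAt (fun s => rad (y s) (a s)) (rad y' (a t) + rad (y t) a') t := by
  refine (((hy 1).fun_mul (ha 1)).fun_add ((hy 2).fun_mul (ha 2))).congr_deriv ?_
  simp [rad]
  ring

lemma hasDerivAt_tang {y a : ℝ → Fin 3 → ℝ} {y' a' : Fin 3 → ℝ} {t : ℝ}
    (hy : ∀ i, HasDerivAt (fun s => y s i) (y' i) t)
    (ha : ∀ i, HasDerivAt (fun s => a s i) (a' i) t) :
    HasDerivAt (fun s => tang (y s) (a s)) (tang y' (a t) + tang (y t) a') t := by
  refine (((hy 1).fun_mul (ha 2)).fun_sub ((hy 2).fun_mul (ha 1))).congr_deriv ?_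
  simp [tang]
  ring

lemma fundTensor_exampleF (hz : z ∈ exampleSet) (u v : Fin 3 → ℝ) :
    fundTensor exampleF z u v = exampleMetric z u v := by
  have hnhds : ∀ w ∈ exampleSet, ∀ᶠ y in nhds w.2, (w.1, y) ∈ exampleSet := fun w hw =>
    (Continuous.prodMk_right w.1).continuousAt.eventually (isOpen_exampleSet.mem_nhds hw)
  have hsq : Differentiable ℝ sqRad := by unfold sqRad; fun_prop
  have hrd : Differentiable ℝ fun y => rad y v := by unfold rad; fun_prop
  have h1 : ∀ y, (z.1, y) ∈ exampleSet → fderiv ℝ (fun y' => exampleF (z.1, y') ^ 2) y v =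
      z.1 2 * (v 0 * √(sqRad y) + y 0 * (rad y v / √(sqRad y))) := by
    intro y hy
    have hq : 0 < sqRad y := sqRad_pos hy
    have he : (fun y' => exampleF (z.1, y') ^ 2) =ᶠ[nhds y]
        fun y' => z.1 2 * (y' 0 * √(sqRad y')) := by
      filter_upwards [hnhds _ hy] with y' hy'
      rw [exampleF_sq hy', mul_assoc]
    rw [he.fderiv_eq]
    refine fderiv_apply_eq_of_line ?_ ((((hasDerivAt_line y v 0).fun_mul
      ((hasDerivAt_sqRad (hasDerivAt_line y v)).sqrt ?_)).const_mul (z.1 2)).congr_deriv ?_)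
    · have := hq.ne'
      fun_prop (disch := assumption)
    · simpa using hq.ne'
    · have : √(sqRad y) ≠ 0 := (Real.sqrt_pos.2 hq).ne'
      simp
      field_simp
      simp
  have he : (fun y => fderiv ℝ (fun y' => exampleF (z.1, y') ^ 2) y v) =ᶠ[nhds z.2]
      fun y => z.1 2 * (v 0 * √(sqRad y) + y 0 * (rad y v / √(sqRad y))) := by
    filter_upwards [hnhds _ hz] with y hy using h1 y hy
  have hq := sqRad_pos hz
  have hρ : √(sqRad z.2) ≠ 0 := (Real.sqrt_pos.2 hq).ne'
  have hs := (hasDerivAt_sqRad (hasDerivAt_line z.2 u)).sqrt (by simpa using hq.ne')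
  rw [fundTensor, he.fderiv_eq, fderiv_apply_eq_of_line ?_ (((hs.const_mul (v 0)).fun_add
    ((hasDerivAt_line z.2 u 0).fun_mul ((hasDerivAt_rad (hasDerivAt_line z.2 u)
      (fun i => hasDerivAt_const 0 (v i))).fun_div hs (by simpa using hρ)))).const_mul (z.1 2))]
  · have e : √(sqRad z.2) ^ 2 = z.2 1 ^ 2 + z.2 2 ^ 2 := Real.sq_sqrt hq.le
    have e' : sqRad z.2 = √(sqRad z.2) ^ 2 := (Real.sq_sqrt hq.le).symm
    simp only [exampleMetric, zero_smul, add_zero]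
    generalize √(sqRad z.2) = ρ at *
    rw [e']
    simp [rad, tang]
    field_simp
    linear_combination z.1 2 * z.2 0 * (u 1 * v 1 + u 2 * v 2) * e
  · have := hq.ne'
    fun_prop (disch := assumption)

lemma exampleMetric_symm (u v : Fin 3 → ℝ) : exampleMetric z u v = exampleMetric z v u := by
  simp only [exampleMetric]; ring

lemma exampleMetric_nondegenerate (hz : z ∈ exampleSet) (u : Fin 3 → ℝ)
    (hu : ∀ v, exampleMetric z u v = 0) : u = 0 := by
  have hq := sqRad_pos hz
  have hφ : z.1 2 / (2 * √(sqRad z.2)) ≠ 0 :=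
    div_ne_zero (x_ne hz) (mul_ne_zero two_ne_zero (Real.sqrt_pos.2 hq).ne')
  -- divide by the conformal factor, then test with `e₁` and the radial and angular vectors
  have h : ∀ v, u 0 * rad z.2 v + v 0 * rad z.2 u
      + z.2 0 / sqRad z.2 * (tang z.2 u * tang z.2 v) = 0 := fun v =>
    (mul_eq_zero.1 (hu v)).resolve_left hφ
  have hrad : rad z.2 u = 0 := by simpa [rad, tang] using h ![1, 0, 0]
  have hu0 : u 0 = 0 := by
    have e := h ![0, z.2 1, z.2 2]
    have e1 : tang z.2 ![0, z.2 1, z.2 2] = 0 := by simp [tang]; ring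
    have e2 : rad z.2 ![0, z.2 1, z.2 2] = sqRad z.2 := by simp [rad, sqRad]; ring
    rw [e1, e2, hrad, mul_zero, mul_zero, mul_zero, add_zero, add_zero] at e
    exact (mul_eq_zero.1 e).resolve_right hq.ne'
  have htang : tang z.2 u = 0 := by
    have e := h ![0, -z.2 2, z.2 1]
    have e1 : tang z.2 ![0, -z.2 2, z.2 1] = sqRad z.2 := by simp [tang, sqRad]; ring
    rw [e1, hu0, hrad, zero_mul, mul_zero, zero_add, zero_add] at e
    have := (mul_eq_zero.1 e).resolve_left (div_ne_zero (y_ne hz) hq.ne')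
    exact (mul_eq_zero.1 this).resolve_right hq.ne'
  have h1 : u 1 = 0 := (mul_eq_zero.1 (by
    rw [sqRad]; rw [rad] at hrad; rw [tang] at htang
    linear_combination z.2 1 * hrad - z.2 2 * htang : sqRad z.2 * u 1 = 0)).resolve_left hq.ne'
  have h2 : u 2 = 0 := (mul_eq_zero.1 (by
    rw [sqRad]; rw [rad] at hrad; rw [tang] at htang
    linear_combination z.2 2 * hrad + z.2 1 * htang : sqRad z.2 * u 2 = 0)).resolve_left hq.ne'
  ext i
  fin_cases i
  exacts [hu0, h1, h2]

lemma isFinslerFunction_exampleF : IsFinslerFunction exampleSet exampleF where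
  isOpen := isOpen_exampleSet
  ne_zero z hz h := y_ne hz (by simp [h])
  conic z hz t ht := by
    refine ⟨?_, ?_⟩
    · have := mul_pos ht hz.1
      simp only [Pi.smul_apply, smul_eq_mul]
      linarith
    · have := mul_ne_zero (pow_ne_zero 2 ht.ne') hz.2
      simp only [Pi.smul_apply, smul_eq_mul]
      convert this using 1
      ring
  smooth := by
    have h1 : ContDiffOn ℝ ∞ (fun z : (Fin 3 → ℝ) × (Fin 3 → ℝ) => √(z.2 1 ^ 2 + z.2 2 ^ 2))
        exampleSet := ContDiffOn.sqrt (by fun_prop) fun z hz => hz.2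
    refine ContDiffOn.sqrt (ContDiffOn.mul (by fun_prop) h1) fun z hz => ?_
    exact mul_ne_zero hz.1.ne' (Real.sqrt_pos.2 (sqRad_pos hz)).ne'
  pos z hz := Real.sqrt_pos.2 (mul_pos hz.1 (Real.sqrt_pos.2 (sqRad_pos hz)))
  homogeneous z hz t ht := by
    have h1 : (t * z.2 1) ^ 2 + (t * z.2 2) ^ 2 = t ^ 2 * (z.2 1 ^ 2 + z.2 2 ^ 2) := by ring
    simp only [exampleF, Pi.smul_apply, smul_eq_mul]
    rw [h1, Real.sqrt_mul (sq_nonneg t), Real.sqrt_sq ht.le,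
      show z.1 2 * (t * z.2 0) * (t * √(z.2 1 ^ 2 + z.2 2 ^ 2))
        = t ^ 2 * (z.1 2 * z.2 0 * √(z.2 1 ^ 2 + z.2 2 ^ 2)) by ring,
      Real.sqrt_mul (sq_nonneg t), Real.sqrt_sq ht.le]
  nondegenerate z hz u hu := exampleMetric_nondegenerate hz u fun v => by
    rw [← fundTensor_exampleF hz, hu]

/-! ### The Cartan connection of the example -/

/-- The Christoffel tensor of the Levi-Civita connection of the metric
`x₃² (dx₂² + dx₃²)` on the `(2, 3)`-plane, extended by zero. -/
def christoffel (x a b : Fin 3 → ℝ) : Fin 3 → ℝ :=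
  ![0, (a 1 * b 2 + a 2 * b 1) / x 2, (a 2 * b 2 - a 1 * b 1) / x 2]

/-- The one-form `d log (y₁ / √(y₂² + y₃²))` along the fibre, at `y`. -/
def lam (y w : Fin 3 → ℝ) : ℝ := w 0 / y 0 - rad y w / sqRad y

/-- The Cartan tensor of `exampleF` with one index raised. -/
def cartanTensor (y w b : Fin 3 → ℝ) : Fin 3 → ℝ :=
  ![-(y 0 * (tang y w * tang y b) / (2 * sqRad y ^ 2)),
    y 1 * (tang y w * tang y b) / (2 * sqRad y ^ 2)
      - y 2 * (lam y w * tang y b + lam y b * tang y w) / (2 * sqRad y),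
    y 2 * (tang y w * tang y b) / (2 * sqRad y ^ 2)
      + y 1 * (lam y w * tang y b + lam y b * tang y w) / (2 * sqRad y)]

/-- The connection form of the Cartan connection of `exampleF`, applied to a fibre vector `b` and a
tangent vector `X`; the argument of the Cartan tensor is the vertical part
`X.2 + Γ(X.1, y)` of `X`. -/
def cartanForm (z : (Fin 3 → ℝ) × (Fin 3 → ℝ)) (b : Fin 3 → ℝ) (X : (Fin 3 → ℝ) × (Fin 3 → ℝ)) :
    Fin 3 → ℝ :=
  christoffel z.1 X.1 b + cartanTensor z.2 (X.2 + christoffel z.1 X.1 z.2) b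

lemma christoffel_comm (x a b : Fin 3 → ℝ) : christoffel x a b = christoffel x b a := by
  ext i; fin_cases i <;> simp [christoffel] <;> ring

lemma christoffel_add (x a b b' : Fin 3 → ℝ) :
    christoffel x a (b + b') = christoffel x a b + christoffel x a b' := by
  ext i; fin_cases i <;> simp [christoffel] <;> ring

lemma christoffel_smul (x a b : Fin 3 → ℝ) (c : ℝ) :
    christoffel x a (c • b) = c • christoffel x a b := by
  ext i; fin_cases i <;> simp [christoffel] <;> ring

lemma christoffel_add_left (x a a' b : Fin 3 → ℝ) :
    christoffel x (a + a') b = christoffel x a b + christoffel x a' b := by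
  simp only [christoffel_comm x _ b, christoffel_add]

lemma christoffel_smul_left (x a b : Fin 3 → ℝ) (c : ℝ) :
    christoffel x (c • a) b = c • christoffel x a b := by
  simp only [christoffel_comm x _ b, christoffel_smul]

lemma cartanTensor_comm (y a b : Fin 3 → ℝ) : cartanTensor y a b = cartanTensor y b a := by
  ext i; fin_cases i <;> simp [cartanTensor] <;> ring

lemma cartanTensor_add (y a b b' : Fin 3 → ℝ) :
    cartanTensor y a (b + b') = cartanTensor y a b + cartanTensor y a b' := by
  ext i; fin_cases i <;> simp [cartanTensor, lam, tang, rad] <;> ring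

lemma cartanTensor_smul (y a b : Fin 3 → ℝ) (c : ℝ) :
    cartanTensor y a (c • b) = c • cartanTensor y a b := by
  ext i; fin_cases i <;> simp [cartanTensor, lam, tang, rad] <;> ring

lemma cartanTensor_add_left (y a a' b : Fin 3 → ℝ) :
    cartanTensor y (a + a') b = cartanTensor y a b + cartanTensor y a' b := by
  simp only [cartanTensor_comm y _ b, cartanTensor_add]

lemma cartanTensor_smul_left (y a b : Fin 3 → ℝ) (c : ℝ) :
    cartanTensor y (c • a) b = c • cartanTensor y a b := by
  simp only [cartanTensor_comm y _ b, cartanTensor_smul]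

/-- The Cartan tensor annihilates `y`, since `g` is homogeneous of degree zero in `y`. -/
lemma cartanTensor_self (hz : z ∈ exampleSet) (w : Fin 3 → ℝ) : cartanTensor z.2 w z.2 = 0 := by
  have h1 : tang z.2 z.2 = 0 := by simp [tang]; ring
  have h2 : lam z.2 z.2 = 0 := by
    have : rad z.2 z.2 = sqRad z.2 := by simp [rad, sqRad]; ring
    rw [lam, this, div_self (y_ne hz), div_self (sqRad_pos hz).ne', sub_self]
  ext i; fin_cases i <;> simp [cartanTensor, h1, h2]

/-- The connection form of the Cartan connection of `exampleF` as a bilinear map. -/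
def cartanFormL (z : (Fin 3 → ℝ) × (Fin 3 → ℝ)) :
    (Fin 3 → ℝ) →L[ℝ] ((Fin 3 → ℝ) × (Fin 3 → ℝ) →L[ℝ] (Fin 3 → ℝ)) :=
  (LinearMap.mk₂ ℝ (cartanForm z)
    (fun b b' X => by simp only [cartanForm, christoffel_add, cartanTensor_add]; abel)
    (fun c b X => by simp only [cartanForm, christoffel_smul, cartanTensor_smul, smul_add])
    (fun b X X' => by
      simp only [cartanForm, Prod.fst_add, Prod.snd_add, christoffel_add_left,
        cartanTensor_add_left]
      abel)
    (fun c b X => by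
      simp only [cartanForm, Prod.smul_fst, Prod.smul_snd, christoffel_smul_left, ← smul_add,
        cartanTensor_smul_left])).toContinuousBilinearMap

lemma cartanFormL_apply (b : Fin 3 → ℝ) (X : (Fin 3 → ℝ) × (Fin 3 → ℝ)) :
    cartanFormL z b X = cartanForm z b X := rfl

/-- The Cartan connection of `exampleF`. -/
def cartanConnection : PullbackDeriv (Fin 3 → ℝ) :=
  fun σ z => fderiv ℝ σ z + cartanFormL z (σ z)

lemma contDiffOn_cartanForm {σ : (Fin 3 → ℝ) × (Fin 3 → ℝ) → (Fin 3 → ℝ)}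
    (hσ : ContDiffOn ℝ ∞ σ exampleSet) (X : (Fin 3 → ℝ) × (Fin 3 → ℝ)) :
    ContDiffOn ℝ ∞ (fun z => cartanForm z (σ z) X) exampleSet := by
  have hq : ∀ z ∈ exampleSet, z.2 1 ^ 2 + z.2 2 ^ 2 ≠ 0 := fun z hz => hz.2
  have hq2 : ∀ z ∈ exampleSet, 2 * (z.2 1 ^ 2 + z.2 2 ^ 2) ≠ 0 := fun z hz =>
    mul_ne_zero two_ne_zero hz.2
  have hq3 : ∀ z ∈ exampleSet, 2 * (z.2 1 ^ 2 + z.2 2 ^ 2) ^ 2 ≠ 0 := fun z hz =>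
    mul_ne_zero two_ne_zero (pow_ne_zero 2 hz.2)
  have hx : ∀ z ∈ exampleSet, z.1 2 ≠ 0 := fun z => x_ne
  have hy : ∀ z ∈ exampleSet, z.2 0 ≠ 0 := fun z => y_ne
  refine contDiffOn_pi.2 fun i => ?_
  fin_cases i <;>
  · simp [cartanForm, christoffel, cartanTensor, lam, tang, rad, sqRad]
    fun_prop (disch := assumption)

lemma isLinearConnection_cartanConnection : IsLinearConnection exampleSet cartanConnection where
  isCovariantDerivative := (isCovariantDerivativeOn_fderiv exampleSet).add_one_form cartanFormL
  smooth σ hσ := by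
    refine (hσ.fderiv_of_isOpen isOpen_exampleSet (by simp)).add ?_
    exact contDiffOn_clm_apply.2 fun X => contDiffOn_cartanForm hσ X

/-- The Cartan tensor with all indices lowered; it is totally symmetric. -/
lemma exampleMetric_cartanTensor (hz : z ∈ exampleSet) (w b c : Fin 3 → ℝ) :
    exampleMetric z (cartanTensor z.2 w b) c =
      z.1 2 / (2 * √(sqRad z.2)) * (z.2 0 / (2 * sqRad z.2) *
        (lam z.2 w * tang z.2 b * tang z.2 c + lam z.2 b * tang z.2 w * tang z.2 c
          + lam z.2 c * tang z.2 w * tang z.2 b)) := by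
  have hq : z.2 1 ^ 2 + z.2 2 ^ 2 ≠ 0 := hz.2
  have hy := y_ne hz
  rw [exampleMetric]
  congr 1
  simp [cartanTensor, lam, rad, tang, sqRad]
  field_simp
  ring

/-- The connection form is compatible with the metric. -/
lemma hasDerivAt_exampleMetric {x y u v : ℝ → Fin 3 → ℝ} {x' y' u' v' : Fin 3 → ℝ} {t : ℝ}
    (hxy : (x t, y t) ∈ exampleSet)
    (hx : ∀ i, HasDerivAt (fun s => x s i) (x' i) t)
    (hy : ∀ i, HasDerivAt (fun s => y s i) (y' i) t)
    (hu : ∀ i, HasDerivAt (fun s => u s i) (u' i) t)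
    (hv : ∀ i, HasDerivAt (fun s => v s i) (v' i) t) :
    HasDerivAt (fun s => exampleMetric (x s, y s) (u s) (v s))
      (exampleMetric (x t, y t) (u' + cartanForm (x t, y t) (u t) (x', y')) (v t)
        + exampleMetric (x t, y t) (u t) (v' + cartanForm (x t, y t) (v t) (x', y'))) t := by
  have hq : 0 < sqRad (y t) := sqRad_pos hxy
  have hx0 : x t 2 ≠ 0 := x_ne hxy
  have hy0 : y t 0 ≠ 0 := y_ne hxy
  have hρ : √(sqRad (y t)) ≠ 0 := (Real.sqrt_pos.2 hq).ne'
  have h1 : HasDerivAt (fun s => x s 2 / (2 * √(sqRad (y s))))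
      (x t 2 / (2 * √(sqRad (y t))) * (x' 2 / x t 2 - rad (y t) y' / sqRad (y t))) t := by
    refine ((hx 2).fun_div (((hasDerivAt_sqRad hy).sqrt hq.ne').const_mul 2)
      (mul_ne_zero two_ne_zero hρ)).congr_deriv ?_
    have e : sqRad (y t) = √(sqRad (y t)) ^ 2 := (Real.sq_sqrt hq.le).symm
    generalize √(sqRad (y t)) = ρ at *
    rw [e]
    field_simp
  refine (h1.fun_mul ((((hu 0).fun_mul (hasDerivAt_rad hy hv)).fun_add
    ((hv 0).fun_mul (hasDerivAt_rad hy hu))).fun_add (((hy 0).fun_div (hasDerivAt_sqRad hy)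
      hq.ne').fun_mul ((hasDerivAt_tang hy hu).fun_mul (hasDerivAt_tang hy hv))))).congr_deriv ?_
  simp only [exampleMetric]
  generalize x t 2 / (2 * √(sqRad (y t))) = φ
  rw [mul_assoc, ← mul_add, ← mul_add]
  congr 1
  have hq' : y t 1 ^ 2 + y t 2 ^ 2 ≠ 0 := hxy.2
  clear h1 hx hy hu hv hxy hρ hq
  simp [cartanForm, christoffel, cartanTensor, lam, rad, tang, sqRad]
  field_simp
  ring

lemma differentiableAt_exampleMetric (hz : z ∈ exampleSet)
    {σ τ : (Fin 3 → ℝ) × (Fin 3 → ℝ) → (Fin 3 → ℝ)}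
    (hσ : DifferentiableAt ℝ σ z) (hτ : DifferentiableAt ℝ τ z) :
    DifferentiableAt ℝ (fun w => exampleMetric w (σ w) (τ w)) z := by
  have hq : z.2 1 ^ 2 + z.2 2 ^ 2 ≠ 0 := hz.2
  have h2 : √(z.2 1 ^ 2 + z.2 2 ^ 2) ≠ 0 := (Real.sqrt_pos.2 (sqRad_pos hz)).ne'
  have h3 : 2 * √(z.2 1 ^ 2 + z.2 2 ^ 2) ≠ 0 := mul_ne_zero two_ne_zero h2
  simp only [exampleMetric, rad, tang, sqRad]
  fun_prop (disch := assumption)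

lemma mem_hor_cartanConnection (hz : z ∈ exampleSet) (X : (Fin 3 → ℝ) × (Fin 3 → ℝ)) :
    X ∈ hor cartanConnection z ↔ X.2 + christoffel z.1 X.1 z.2 = 0 := by
  rw [mem_hor_iff (A := cartanFormL z) (fun _ _ => rfl), cartanFormL_apply, cartanForm,
    cartanTensor_self hz, add_zero]

lemma cartanForm_of_hor (b : Fin 3 → ℝ) {X : (Fin 3 → ℝ) × (Fin 3 → ℝ)}
    (hX : X.2 + christoffel z.1 X.1 z.2 = 0) : cartanForm z b X = christoffel z.1 X.1 b := by
  have : cartanTensor z.2 0 b = 0 := by simpa using cartanTensor_smul_left z.2 0 b 0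
  rw [cartanForm, hX, this, add_zero]

lemma christoffel_zero_left (x b : Fin 3 → ℝ) : christoffel x 0 b = 0 := by
  simpa using christoffel_smul_left x 0 b 0

lemma cartanForm_vert (b v : Fin 3 → ℝ) : cartanForm z b (0, v) = cartanTensor z.2 v b := by
  simp [cartanForm, christoffel_zero_left]

lemma isCartanConnection_cartanConnection :
    IsCartanConnection exampleSet exampleF cartanConnection where
  isLinearConnection := isLinearConnection_cartanConnection
  regular z hz := by
    constructor
    · rw [Submodule.disjoint_def]
      intro X hV hH
      have hX : X.1 = 0 := hV
      rw [mem_hor_cartanConnection hz, hX, christoffel_zero_left, add_zero] at hH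
      exact Prod.ext hX hH
    · rw [codisjoint_iff, Submodule.eq_top_iff']
      intro X
      refine Submodule.mem_sup.2 ⟨(0, X.2 + christoffel z.1 X.1 z.2), by simp [vert],
        (X.1, -christoffel z.1 X.1 z.2), (mem_hor_cartanConnection hz _).2 (by simp), ?_⟩
      ext <;> simp
  metrical σ τ hσ hτ z hz X := by
    have hz' := isOpen_exampleSet.mem_nhds hz
    have hσ' := (hσ.contDiffAt hz').differentiableAt (by simp)
    have hτ' := (hτ.contDiffAt hz').differentiableAt (by simp)
    have he : (fun w => fundTensor exampleF w (σ w) (τ w)) =ᶠ[nhds z]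
        fun w => exampleMetric w (σ w) (τ w) := by
      filter_upwards [hz'] with w hw using fundTensor_exampleF hw _ _
    rw [he.fderiv_eq, fundTensor_exampleF hz, fundTensor_exampleF hz]
    refine fderiv_apply_eq_of_line (differentiableAt_exampleMetric hz hσ' hτ') ?_
    have key : ∀ ρ : (Fin 3 → ℝ) × (Fin 3 → ℝ) → (Fin 3 → ℝ), DifferentiableAt ℝ ρ z →
        ∀ i, HasDerivAt (fun t : ℝ => ρ (z + t • X) i) (fderiv ℝ ρ z X i) 0 := fun ρ hρ =>
      hasDerivAt_pi.1 (hρ.hasFDerivAt.hasLineDerivAt X)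
    have := hasDerivAt_exampleMetric (x := fun t => z.1 + t • X.1) (y := fun t => z.2 + t • X.2)
      (u := fun t => σ (z + t • X)) (v := fun t => τ (z + t • X)) (t := 0)
      (by simpa using hz) (hasDerivAt_line _ _) (hasDerivAt_line _ _) (key σ hσ') (key τ hτ')
    simp only [zero_smul, add_zero] at this
    exact this
  torsion_hor z hz X hX Y hY := by
    rw [torsionAt_eq (A := cartanFormL z) (fun _ _ => rfl), cartanFormL_apply, cartanFormL_apply,
      cartanForm_of_hor _ ((mem_hor_cartanConnection hz X).1 hX),
      cartanForm_of_hor _ ((mem_hor_cartanConnection hz Y).1 hY), christoffel_comm, sub_self]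
  torsion_symm z hz X hX Y hY Z hZ := by
    obtain ⟨a, v⟩ := X
    obtain rfl : a = 0 := hX
    rw [torsionAt_eq (A := cartanFormL z) (fun _ _ => rfl),
      torsionAt_eq (A := cartanFormL z) (fun _ _ => rfl)]
    simp only [cartanFormL_apply, map_zero, zero_apply, sub_zero,
      cartanForm_vert]
    rw [fundTensor_exampleF hz, fundTensor_exampleF hz, exampleMetric_cartanTensor hz,
      exampleMetric_cartanTensor hz]
    ring

/-- Every Cartan connection of `exampleF` agrees with `cartanConnection` on sections that are
differentiable at the point. -/
lemma IsCartanConnection.eq_cartanConnection {D : PullbackDeriv (Fin 3 → ℝ)}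
    (hD : IsCartanConnection exampleSet exampleF D)
    {σ : (Fin 3 → ℝ) × (Fin 3 → ℝ) → (Fin 3 → ℝ)} (hz : z ∈ exampleSet)
    (hσ : DifferentiableAt ℝ σ z) : D σ z = cartanConnection σ z := by
  obtain ⟨A, hA⟩ := hD.isLinearConnection.exists_connectionForm hz
  have : A = cartanFormL z :=
    hD.connectionForm_eq isCartanConnection_cartanConnection hz (exampleMetricForm z)
      (fundTensor_exampleF hz) exampleMetric_symm (exampleMetric_nondegenerate hz) hA
      (fun _ _ => rfl) fun v => by
        rw [cartanFormL_apply, cartanForm_vert, cartanTensor_self hz]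
  rw [hA σ hσ, this]
  rfl

/-! ### The h-curvature, its nullity space and its kernel -/

lemma hasDerivAt_christoffel {x b : ℝ → Fin 3 → ℝ} {x' b' : Fin 3 → ℝ} {t : ℝ} (a : Fin 3 → ℝ)
    (hx : ∀ i, HasDerivAt (fun s => x s i) (x' i) t) (hb : ∀ i, HasDerivAt (fun s => b s i) (b' i) t)
    (h0 : x t 2 ≠ 0) :
    HasDerivAt (fun s => christoffel (x s) a (b s))
      (-(x' 2 / x t 2) • christoffel (x t) a (b t) + christoffel (x t) a b') t := by
  refine hasDerivAt_pi.2 fun i => ?_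
  fin_cases i
  · simpa [christoffel] using hasDerivAt_const t (0 : ℝ)
  · refine ((((hb 2).const_mul (a 1)).fun_add ((hb 1).const_mul (a 2))).fun_div (hx 2)
      h0).congr_deriv ?_
    simp [christoffel]
    field_simp
    ring
  · refine ((((hb 2).const_mul (a 2)).fun_sub ((hb 1).const_mul (a 1))).fun_div (hx 2)
      h0).congr_deriv ?_
    simp [christoffel]
    field_simp
    ring

/-- Where its argument `u` vanishes, the derivative of the Cartan tensor along a curve only involves
the derivative of `u`. -/
lemma hasDerivAt_cartanTensor {y u : ℝ → Fin 3 → ℝ} {y' u' : Fin 3 → ℝ} {t : ℝ} (b : Fin 3 → ℝ)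
    (hy : ∀ i, HasDerivAt (fun s => y s i) (y' i) t) (hu : ∀ i, HasDerivAt (fun s => u s i) (u' i) t)
    (h0 : y t 0 ≠ 0) (hq : sqRad (y t) ≠ 0) (hut : u t = 0) :
    HasDerivAt (fun s => cartanTensor (y s) (u s) b) (cartanTensor (y t) u' b) t := by
  have hsum : ∀ y u, cartanTensor y u b = ∑ i, u i • cartanTensor y (Pi.single i 1) b := by
    intro y u
    have hu : u = u 0 • Pi.single 0 1 + u 1 • Pi.single 1 1 + u 2 • Pi.single 2 1 := by
      ext i; fin_cases i <;> simp
    rw [Fin.sum_univ_three]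
    conv_lhs => rw [hu]
    simp only [cartanTensor_add_left, cartanTensor_smul_left]
  have hd : ∀ e, DifferentiableAt ℝ (fun s => cartanTensor (y s) e b) t := by
    intro e
    have h0' := (hy 0).differentiableAt
    have h1' := (hy 1).differentiableAt
    have h2' := (hy 2).differentiableAt
    have hq1 : y t 1 ^ 2 + y t 2 ^ 2 ≠ 0 := hq
    have hq2 : 2 * (y t 1 ^ 2 + y t 2 ^ 2) ≠ 0 := mul_ne_zero two_ne_zero hq
    have hq3 : 2 * (y t 1 ^ 2 + y t 2 ^ 2) ^ 2 ≠ 0 := mul_ne_zero two_ne_zero (pow_ne_zero 2 hq)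
    refine differentiableAt_pi.2 fun i => ?_
    fin_cases i <;>
    · simp [cartanTensor, lam, tang, rad, sqRad]
      fun_prop (disch := assumption)
  rw [hsum (y t) u', funext fun s => hsum (y s) (u s)]
  refine (HasDerivAt.fun_sum fun i _ => (hu i).fun_smul (hd _).hasDerivAt).congr_deriv ?_
  simp [hut]

/-- The infinitesimal rotation of the `(2, 3)`-plane, extended by zero to the first axis. -/
def rot (v : Fin 3 → ℝ) : Fin 3 → ℝ := ![0, v 2, -v 1]

/-- The curvature of `christoffel`. -/
lemma christoffel_curvature {x : Fin 3 → ℝ} (hx : x 2 ≠ 0) (a b v : Fin 3 → ℝ) :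
    (-(a 2 / x 2) • christoffel x b v + christoffel x a (christoffel x b v))
      - (-(b 2 / x 2) • christoffel x a v + christoffel x b (christoffel x a v))
      = ((a 1 * b 2 - a 2 * b 1) / x 2 ^ 2) • rot v := by
  ext i
  fin_cases i <;> simp [christoffel, rot] <;> field_simp <;> ring

/-- The derivative of the connection form on a constant vector `Y` that is horizontal at `z`: the
argument of the Cartan tensor vanishes at `z`, so the derivative of the Cartan tensor drops out. -/
lemma fderiv_cartanForm (hz : z ∈ exampleSet) (Z : Fin 3 → ℝ) {X Y : (Fin 3 → ℝ) × (Fin 3 → ℝ)}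
    (hX : X.2 + christoffel z.1 X.1 z.2 = 0) (hY : Y.2 + christoffel z.1 Y.1 z.2 = 0) :
    fderiv ℝ (fun w => cartanForm w Z Y) z X =
      -(X.1 2 / z.1 2) • christoffel z.1 Y.1 Z
        + cartanTensor z.2 (-(X.1 2 / z.1 2) • christoffel z.1 Y.1 z.2
          - christoffel z.1 Y.1 (christoffel z.1 X.1 z.2)) Z := by
  have hd : DifferentiableAt ℝ (fun w => cartanForm w Z Y) z :=
    ((contDiffOn_cartanForm contDiffOn_const Y).contDiffAt
      (isOpen_exampleSet.mem_nhds hz)).differentiableAt (by simp)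
  refine fderiv_apply_eq_of_line hd ?_
  have hx0 : (z.1 + (0 : ℝ) • X.1) 2 ≠ 0 := by simpa using x_ne hz
  have h1 := hasDerivAt_christoffel Y.1 (hasDerivAt_line z.1 X.1)
    (fun i => hasDerivAt_const 0 (Z i)) hx0
  have h2 := (hasDerivAt_christoffel Y.1 (hasDerivAt_line z.1 X.1) (hasDerivAt_line z.2 X.2)
    hx0).const_add Y.2
  have h3 := hasDerivAt_cartanTensor Z (hasDerivAt_line z.2 X.2) (hasDerivAt_pi.1 h2)
    (by simpa using y_ne hz) (by simpa using (sqRad_pos hz).ne') (by simpa using hY)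
  refine (h1.fun_add h3).congr_deriv ?_
  have hc : ∀ v, christoffel z.1 Y.1 (-v) = -christoffel z.1 Y.1 v := fun v => by
    simpa using christoffel_smul z.1 Y.1 v (-1)
  have hc0 : christoffel z.1 Y.1 0 = 0 := by
    simpa using christoffel_smul z.1 Y.1 0 0
  simp only [zero_smul, add_zero]
  rw [eq_neg_of_add_eq_zero_left hX, hc, sub_eq_add_neg]
  congr 1
  exact (congrArg _ hc0).trans (add_zero _)

variable {D : PullbackDeriv (Fin 3 → ℝ)}

lemma IsCartanConnection.mem_hor (hD : IsCartanConnection exampleSet exampleF D)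
    (hz : z ∈ exampleSet) (X : (Fin 3 → ℝ) × (Fin 3 → ℝ)) :
    X ∈ hor D z ↔ X.2 + christoffel z.1 X.1 z.2 = 0 := by
  rw [← mem_hor_cartanConnection hz, hor, hor,
    hD.eq_cartanConnection (σ := eta) hz differentiableAt_snd]

/-- The h-curvature of the Cartan connection of `exampleF`. -/
lemma IsCartanConnection.curvatureAt_hor (hD : IsCartanConnection exampleSet exampleF D)
    (hz : z ∈ exampleSet) {X Y : (Fin 3 → ℝ) × (Fin 3 → ℝ)}
    (hX : X ∈ hor D z) (hY : Y ∈ hor D z) (Z : Fin 3 → ℝ) :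
    curvatureAt D z X Y Z = ((X.1 1 * Y.1 2 - X.1 2 * Y.1 1) / z.1 2 ^ 2) •
      (rot Z + cartanTensor z.2 (rot z.2) Z) := by
  rw [hD.mem_hor hz] at hX hY
  have hd : ∀ X, DifferentiableAt ℝ (fun w => cartanFormL w Z X) z := fun X =>
    ((contDiffOn_cartanForm contDiffOn_const X).contDiffAt
      (isOpen_exampleSet.mem_nhds hz)).differentiableAt (by simp)
  rw [curvatureAt_eq (A := cartanFormL) isOpen_exampleSet
    (fun w hw σ hσ => hD.eq_cartanConnection hw hσ) hz X Y Z (hd X) (hd Y)]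
  simp only [cartanFormL_apply]
  rw [fderiv_cartanForm hz Z hX hY, fderiv_cartanForm hz Z hY hX]
  simp only [cartanForm_of_hor _ hX, cartanForm_of_hor _ hY]
  rw [smul_add, ← cartanTensor_smul_left, ← christoffel_curvature (x_ne hz),
    ← christoffel_curvature (x_ne hz)]
  have hs : ∀ u v, cartanTensor z.2 (u - v) Z = cartanTensor z.2 u Z - cartanTensor z.2 v Z := by
    intro u v
    rw [eq_sub_iff_add_eq, ← cartanTensor_add_left, sub_add_cancel]
  simp only [hs, cartanTensor_add_left]
  abel

/-- The vectors annihilated by the h-curvature operator. -/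
lemma rot_add_cartanTensor_eq_zero_iff (hz : z ∈ exampleSet) (Z : Fin 3 → ℝ) :
    rot Z + cartanTensor z.2 (rot z.2) Z = 0 ↔
      Z ∈ Submodule.span ℝ {(![1, -(z.2 1 / z.2 0), -(z.2 2 / z.2 0)] : Fin 3 → ℝ)} := by
  have hq := (sqRad_pos hz).ne'
  have hq' : z.2 1 ^ 2 + z.2 2 ^ 2 ≠ 0 := hz.2
  have hy := y_ne hz
  have htang : tang z.2 (rot z.2) = - sqRad z.2 := by simp [tang, rot, sqRad]; ring
  have hlam : lam z.2 (rot z.2) = 0 := by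
    have : rad z.2 (rot z.2) = 0 := by simp [rad, rot]; ring
    rw [lam, this]
    simp [rot]
  have hT : cartanTensor z.2 (rot z.2) Z =
      ![z.2 0 * tang z.2 Z / (2 * sqRad z.2),
        - (z.2 1 * tang z.2 Z / (2 * sqRad z.2)) + z.2 2 * lam z.2 Z / 2,
        - (z.2 2 * tang z.2 Z / (2 * sqRad z.2)) - z.2 1 * lam z.2 Z / 2] := by
    ext i
    fin_cases i <;> simp [cartanTensor, htang, hlam] <;> field_simp
    all_goals ring
  rw [hT, Submodule.mem_span_singleton]
  constructor
  · intro h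
    have h0 := congrFun h 0
    have h1 := congrFun h 1
    have h2 := congrFun h 2
    simp [rot, hy, hq] at h0
    simp [rot, h0] at h1 h2
    rw [lam] at h1 h2
    have hR : sqRad z.2 * (rad z.2 Z / sqRad z.2) = z.2 1 * Z 1 + z.2 2 * Z 2 :=
      mul_div_cancel₀ _ hq
    have hs : sqRad z.2 = z.2 1 ^ 2 + z.2 2 ^ 2 := rfl
    have e : Z 0 / z.2 0 + rad z.2 Z / sqRad z.2 = 0 := by
      refine (mul_eq_zero.1 ?_).resolve_left hq
      linear_combination 2 * (z.2 2 * h1 - z.2 1 * h2) + 2 * hR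
        + (Z 0 / z.2 0 - rad z.2 Z / sqRad z.2) * hs
    refine ⟨Z 0, ?_⟩
    ext i
    fin_cases i
    · simp
    · simp
      linear_combination h2 - z.2 1 / 2 * e
    · simp
      linear_combination -h1 - z.2 2 / 2 * e
  · rintro ⟨c, rfl⟩
    have htv : tang z.2 (c • ![1, -(z.2 1 / z.2 0), -(z.2 2 / z.2 0)]) = 0 := by
      simp [tang]; ring
    have hlv : lam z.2 (c • ![1, -(z.2 1 / z.2 0), -(z.2 2 / z.2 0)]) = 2 * c / z.2 0 := by
      simp [lam, rad, sqRad]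
      field_simp
      ring
    rw [htv, hlv]
    ext i
    fin_cases i <;> simp [rot]
    all_goals
      field_simp
      ring

lemma IsCartanConnection.exists_mem_hor (hD : IsCartanConnection exampleSet exampleF D)
    (hz : z ∈ exampleSet) (a : Fin 3 → ℝ) : ∃ X ∈ hor D z, X.1 = a :=
  ⟨(a, -christoffel z.1 a z.2), (hD.mem_hor hz _).2 (by simp), rfl⟩

lemma IsCartanConnection.kernel_eq (hD : IsCartanConnection exampleSet exampleF D)
    (hz : z ∈ exampleSet) :
    kernel D z = (Submodule.span ℝ {(![1, -(z.2 1 / z.2 0), -(z.2 2 / z.2 0)] : Fin 3 → ℝ)} :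
      Set (Fin 3 → ℝ)) := by
  ext Z
  rw [SetLike.mem_coe, ← rot_add_cartanTensor_eq_zero_iff hz]
  constructor
  · intro h
    obtain ⟨X, hX, hX1⟩ := hD.exists_mem_hor hz ![0, 1, 0]
    obtain ⟨Y, hY, hY1⟩ := hD.exists_mem_hor hz ![0, 0, 1]
    have := h X hX Y hY
    rw [hD.curvatureAt_hor hz hX hY] at this
    exact (smul_eq_zero.1 this).resolve_left (by simp [hX1, hY1, x_ne hz])
  · intro h X hX Y hY
    rw [hD.curvatureAt_hor hz hX hY, h, smul_zero]

lemma IsCartanConnection.nullity_eq (hD : IsCartanConnection exampleSet exampleF D)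
    (hz : z ∈ exampleSet) :
    nullity D z = (Submodule.span ℝ {(![1, 0, 0] : Fin 3 → ℝ)} : Set (Fin 3 → ℝ)) := by
  ext a
  rw [SetLike.mem_coe, Submodule.mem_span_singleton]
  constructor
  · rintro ⟨X, ⟨hX, h⟩, rfl⟩
    -- the operator multiplying the area form is nonzero, as its value at `y` is `rot y`
    have hrot : rot z.2 + cartanTensor z.2 (rot z.2) z.2 ≠ 0 := by
      rw [cartanTensor_self hz, add_zero]
      intro h0
      have h1 := congrFun h0 1
      have h2 := congrFun h0 2
      simp [rot] at h1 h2
      exact hz.2 (by simp [h1, h2])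
    have hκ : ∀ b : Fin 3 → ℝ, X.1 1 * b 2 - X.1 2 * b 1 = 0 := by
      intro b
      obtain ⟨Y, hY, rfl⟩ := hD.exists_mem_hor hz b
      have := h Y hY z.2
      rw [hD.curvatureAt_hor hz hX hY] at this
      have := (smul_eq_zero.1 this).resolve_right hrot
      exact (div_eq_zero_iff.1 this).resolve_right (pow_ne_zero 2 (x_ne hz))
    have h1 : X.1 1 = 0 := by simpa using hκ ![0, 0, 1]
    have h2 : X.1 2 = 0 := by simpa using hκ ![0, 1, 0]
    refine ⟨X.1 0, ?_⟩
    ext i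
    fin_cases i <;> simp [h1, h2]
  · rintro ⟨c, rfl⟩
    obtain ⟨X, hX, hX1⟩ := hD.exists_mem_hor hz (c • ![1, 0, 0])
    refine ⟨X, ⟨hX, fun Y hY Z => ?_⟩, hX1⟩
    rw [hD.curvatureAt_hor hz hX hY]
    simp [hX1]

lemma IsCartanConnection.nullity_ne_kernel (hD : IsCartanConnection exampleSet exampleF D)
    (hz : z ∈ exampleSet) : nullity D z ≠ kernel D z := by
  intro h
  have hmem : (![1, 0, 0] : Fin 3 → ℝ) ∈ kernel D z := by
    rw [← h, hD.nullity_eq hz]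
    exact Submodule.mem_span_singleton_self _
  rw [hD.kernel_eq hz, SetLike.mem_coe, Submodule.mem_span_singleton] at hmem
  obtain ⟨c, hc⟩ := hmem
  have h0 := congrFun hc 0
  have h1 := congrFun hc 1
  have h2 := congrFun hc 2
  simp at h0
  simp [h0, y_ne hz] at h1 h2
  exact hz.2 (by simp [h1, h2])

lemma exampleSet_nonempty : exampleSet.Nonempty :=
  ⟨(![0, 0, 1], ![1, 1, 0]), by simp [exampleSet]⟩

end Example

end Finsler

theorem theorem1 :
    -- the nullity space and the kernel do not coincide in general
    (¬ ∀ (n : ℕ) (U : Set ((Fin n → ℝ) × (Fin n → ℝ))) (F : (Fin n → ℝ) × (Fin n → ℝ) → ℝ)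
        (D : Finsler.PullbackDeriv (Fin n → ℝ)),
        Finsler.IsFinslerFunction U F → Finsler.IsCartanConnection U F D →
        ∀ z ∈ U, Finsler.nullity D z = Finsler.kernel D z) ∧
    -- the counterexample: a Finsler function on a nonempty set
    Finsler.exampleSet.Nonempty ∧
    Finsler.IsFinslerFunction Finsler.exampleSet Finsler.exampleF ∧
    -- its Cartan connection exists and is unique
    (∃ D, Finsler.IsCartanConnection Finsler.exampleSet Finsler.exampleF D) ∧
    (∀ D D', Finsler.IsCartanConnection Finsler.exampleSet Finsler.exampleF D →
      Finsler.IsCartanConnection Finsler.exampleSet Finsler.exampleF D' →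
      ∀ (σ : (Fin 3 → ℝ) × (Fin 3 → ℝ) → (Fin 3 → ℝ)), ContDiffOn ℝ (⊤ : ℕ∞) σ Finsler.exampleSet →
        ∀ z ∈ Finsler.exampleSet, D σ z = D' σ z) ∧
    -- its nullity space and its kernel at every point
    (∀ D, Finsler.IsCartanConnection Finsler.exampleSet Finsler.exampleF D →
      ∀ z ∈ Finsler.exampleSet,
        Finsler.nullity D z =
          (Submodule.span ℝ {(![1, 0, 0] : Fin 3 → ℝ)} : Set (Fin 3 → ℝ)) ∧
        Finsler.kernel D z =
          (Submodule.span ℝ {(![1, -(z.2 1 / z.2 0), -(z.2 2 / z.2 0)] : Fin 3 → ℝ)} :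
            Set (Fin 3 → ℝ)) ∧
        Finsler.nullity D z ≠ Finsler.kernel D z) := by
  refine ⟨fun h => ?_, Finsler.exampleSet_nonempty, Finsler.isFinslerFunction_exampleF,
    ⟨_, Finsler.isCartanConnection_cartanConnection⟩, fun D D' hD hD' σ hσ z hz => ?_,
    fun D hD z hz => ⟨hD.nullity_eq hz, hD.kernel_eq hz, hD.nullity_ne_kernel hz⟩⟩
  · obtain ⟨z, hz⟩ := Finsler.exampleSet_nonempty
    exact Finsler.isCartanConnection_cartanConnection.nullity_ne_kernel hz
      (h 3 _ _ _ Finsler.isFinslerFunction_exampleF Finsler.isCartanConnection_cartanConnection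
        z hz)
  · have hσ' : DifferentiableAt ℝ σ z :=
      (hσ.contDiffAt (Finsler.isOpen_exampleSet.mem_nhds hz)).differentiableAt (by simp)
    rw [hD.eq_cartanConnection hz hσ', hD'.eq_cartanConnection hz hσ']
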